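/- A Steiner triple system $\mathrm{STS}(v)$ is a pair $(X,\mathcal B)$, where $X$ is a set of $v$ points and $\mathcal B$ is a collection of $3$-subsets of $X$ (blocks) such that every $2$-subset of $X$ is contained in exactly one block. For a positive integer $k$, a zero-sum $k$-flow of $(X,\mathcal B)$ is a function $f:\mathcal B\to\{\pm1,\dots,\pm(k-1)\}$ such that $\sum_{B\in\mathcal B,\,x\in B} f(B)=0$ for every $x\in X$. The system $(X,\mathcal B)$ is embedded in $(X',\mathcal B')$ if, up to renaming of points, $X\subseteq X'$ and $\mathcal B\subseteq\mathcal B'$. **Theorem.** Suppose that one of the following conditions holds: - $k\ge 3$, $v\equiv 3$ or $7 \pmod{12}$, and $v>7$; - $k\ge 4$, $v\equiv 9\pmod{12}$, and $v>9$; - $k\ge 5$, and either $v\equiv 1\pmod{12}$ with $v>1$, or $v=9$. Then every $\mathrm{STS}(v)$ that admits a zero-sum $k$-flow can be embedded in an $\mathrm{STS}(2v+1)$ that admits a zero-sum $k$-flow. Moreover, for any given zero-sum $k$-flow $f$ of the $\mathrm{STS}(v)$, the $\mathrm{STS}(2v+1)$ and its zero-sum $k$-flow can be chosen so that the flow agrees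 with $f$ on the blocks of the embedded $\mathrm{STS}(v)$. -/

import Mathlib

universe u v

/-- A Steiner triple system of order `n` on the finite point set `X`, i.e. a `2`-`(n, 3, 1)` design:
`X` has `n` points, every block is a `3`-subset of `X`, and every two distinct points lie together
in exactly one block. -/
structure SteinerTripleSystem (n : ℕ) (X : Type u) [Fintype X] where
  /-- the collection of blocks -/
  blocks : Finset (Finset X)
  card_points : Fintype.card X = n
  card_block : ∀ B ∈ blocks, B.card = 3
  existsUnique_block : ∀ x y : X, x ≠ y → ∃! B : Finset X, B ∈ blocks ∧ x ∈ B ∧ y ∈ B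

namespace SteinerTripleSystem

open Classical in
/-- A zero-sum `k`-flow of `S`: a function from the blocks to `{±1, …, ±(k-1)}` such that the
weights of the blocks through any point sum to zero. -/
def IsZeroSumFlow {n : ℕ} {X : Type u} [Fintype X] (S : SteinerTripleSystem n X) (k : ℕ)
    (f : {B : Finset X // B ∈ S.blocks} → ℤ) : Prop :=
  (∀ B, 1 ≤ |f B| ∧ |f B| ≤ (k : ℤ) - 1) ∧
    ∀ x : X, ∑ B : {B : Finset X // B ∈ S.blocks} with x ∈ B.1, f B = 0

/-- An embedding of `S` into `T`: an injection of the points that carries blocks to blocks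
(that is, up to renaming points, the points and the blocks of `S` are among those of `T`). -/
structure Embedding {n m : ℕ} {X : Type u} {Y : Type v} [Fintype X] [Fintype Y]
    (S : SteinerTripleSystem n X) (T : SteinerTripleSystem m Y) where
  /-- the injection of the points -/
  points : X ↪ Y
  map_mem : ∀ B ∈ S.blocks, B.map points ∈ T.blocks

/-- The block of `T` that is the image of a block of `S`. -/
def Embedding.mapBlock {n m : ℕ} {X : Type u} {Y : Type v} [Fintype X] [Fintype Y]
    {S : SteinerTripleSystem n X} {T : SteinerTripleSystem m Y} (e : S.Embedding T)
    (B : {B : Finset X // B ∈ S.blocks}) : {B : Finset Y // B ∈ T.blocks} :=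
  ⟨B.1.map e.points, e.map_mem B.1 B.2⟩

end SteinerTripleSystem

/-! This is the doubling construction `v → 2v + 1`. Adjoin a set `Y` of `v + 1` new points, match
the old points `x` with the factors of a one-factorization of the complete graph on `Y`, and add the
blocks `{x, y, y'}` with `yy'` an edge of the factor `x`. Old blocks keep their weights, so at an
old point the new weights must cancel along its factor, and at a new point around the vertex.

It remains to weight the edges by `±1`, `±2` (whence `k ≥ 3`) with both kinds of sum zero;
`exists_isZeroSumFactorization` does this for odd `v ≥ 7`. If `v ≡ 3 (mod 4)`, a one-factorization
of half the size is doubled; if `v ≡ 1 (mod 4)`, the half size is odd and a cyclic construction on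
two copies of `ℤ/(2h+1)` is used. Both take their weights from zero-sum arrays. -/

/-! ### Zero-sum arrays -/

/-- An array of integers `±1`, `±2` all of whose row and column sums vanish. -/
structure IsZeroSumArray {α β : Type*} [Fintype α] [Fintype β] (ψ : α → β → ℤ) : Prop where
  bound : ∀ i j, 1 ≤ |ψ i j| ∧ |ψ i j| ≤ 2
  sum_row : ∀ i, ∑ j, ψ i j = 0
  sum_col : ∀ j, ∑ i, ψ i j = 0

namespace IsZeroSumArray

theorem transpose {α β : Type*} [Fintype α] [Fintype β] {ψ : α → β → ℤ} (h : IsZeroSumArray ψ) :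
    IsZeroSumArray fun j i => ψ i j :=
  ⟨fun j i => h.bound i j, h.sum_col, h.sum_row⟩

theorem comp_equiv {α β α' β' : Type*} [Fintype α] [Fintype β] [Fintype α'] [Fintype β']
    {ψ : α → β → ℤ} (h : IsZeroSumArray ψ) (e : α' ≃ α) (e' : β' ≃ β) :
    IsZeroSumArray fun i j => ψ (e i) (e' j) :=
  ⟨fun _ _ => h.bound _ _, fun i => (e'.sum_comp (ψ (e i))).trans (h.sum_row _),
    fun j => (e.sum_comp fun i => ψ i (e' j)).trans (h.sum_col _)⟩

theorem append {a a' : ℕ} {β : Type*} [Fintype β] {ψ : Fin a → β → ℤ} {ψ' : Fin a' → β → ℤ}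
    (h : IsZeroSumArray ψ) (h' : IsZeroSumArray ψ') : IsZeroSumArray (Fin.append ψ ψ') := by
  refine ⟨fun i => ?_, fun i => ?_, fun j => ?_⟩
  · refine Fin.addCases (fun i => ?_) (fun i => ?_) i
    · simpa using h.bound i
    · simpa using h'.bound i
  · refine Fin.addCases (fun i => ?_) (fun i => ?_) i
    · simpa using h.sum_row i
    · simpa using h'.sum_row i
  · simp [Fin.sum_univ_add, h.sum_col, h'.sum_col]

end IsZeroSumArray

/-- Induction in steps of two, from `2` and `3`. -/
theorem Nat.two_three_induction {P : ℕ → Prop} (h2 : P 2) (h3 : P 3) (h : ∀ a, P a → P (a + 2)) :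
    ∀ a, 2 ≤ a → P a
  | 0, h0 => by omega
  | 1, h1 => by omega
  | 2, _ => h2
  | 3, _ => h3
  | a + 4, _ => h _ (Nat.two_three_induction h2 h3 h (a + 2) (by omega))

/-- Tile by `2 × 2`, `2 × 3`, `3 × 2` and `3 × 3` arrays: stacking preserves both kinds of sum, and
every integer `≥ 2` is a sum of `2`s and `3`s. -/
theorem exists_isZeroSumArray_fin (a b : ℕ) (ha : 2 ≤ a) (hb : 2 ≤ b) :
    ∃ ψ : Fin a → Fin b → ℤ, IsZeroSumArray ψ := by
  have h22 : IsZeroSumArray (![![1, -1], ![-1, 1]] : Fin 2 → Fin 2 → ℤ) :=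
    ⟨by decide, by decide, by decide⟩
  have h23 : IsZeroSumArray (![![1, 1, -2], ![-1, -1, 2]] : Fin 2 → Fin 3 → ℤ) :=
    ⟨by decide, by decide, by decide⟩
  have h33 : IsZeroSumArray (![![1, 1, -2], ![1, -2, 1], ![-2, 1, 1]] : Fin 3 → Fin 3 → ℤ) :=
    ⟨by decide, by decide, by decide⟩
  have key : ∀ b, (∃ ψ : Fin 2 → Fin b → ℤ, IsZeroSumArray ψ) →
      (∃ ψ : Fin 3 → Fin b → ℤ, IsZeroSumArray ψ) →
      ∀ a, 2 ≤ a → ∃ ψ : Fin a → Fin b → ℤ, IsZeroSumArray ψ := fun b h2 h3 =>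
    Nat.two_three_induction h2 h3 fun _ ⟨_, h⟩ => h2.imp' _ fun _ h' => h.append h'
  have h2 := key 2 ⟨_, h22⟩ ⟨_, h23.transpose⟩
  have h3 := key 3 ⟨_, h23⟩ ⟨_, h33⟩
  obtain ⟨ψ, hψ⟩ := key a ((h2 a ha).imp' _ fun _ h => h.transpose)
    ((h3 a ha).imp' _ fun _ h => h.transpose) b hb
  exact ⟨_, hψ.transpose⟩

theorem exists_isZeroSumArray (α β : Type*) [Fintype α] [Fintype β] [Nontrivial α] [Nontrivial β] :
    ∃ ψ : α → β → ℤ, IsZeroSumArray ψ := by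
  obtain ⟨ψ, hψ⟩ := exists_isZeroSumArray_fin (Fintype.card α) (Fintype.card β)
    Fintype.one_lt_card Fintype.one_lt_card
  exact ⟨_, hψ.comp_equiv (Fintype.equivFin α) (Fintype.equivFin β)⟩

/-! ### Arrays invariant under an involution -/

/-- The orbits of an involution. -/
def Function.Involutive.orbitSetoid {P : Type*} {τ : P → P} (h : Function.Involutive τ) :
    Setoid P where
  r p q := q = p ∨ q = τ p
  iseqv := by
    refine ⟨fun p => Or.inl rfl, ?_, ?_⟩
    · rintro p q (rfl | rfl)
      · exact Or.inl rfl
      · exact Or.inr (h p).symm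
    · rintro p q r (rfl | rfl) (rfl | rfl)
      · exact Or.inl rfl
      · exact Or.inr rfl
      · exact Or.inr rfl
      · exact Or.inl (h p)

open Classical in
theorem Function.Involutive.sum_orbit {P : Type*} [Fintype P] {τ : P → P}
    (h : Function.Involutive τ) (hτ : ∀ p, τ p ≠ p) (φ : Quotient h.orbitSetoid → ℤ) :
    ∑ p, φ (Quotient.mk _ p) = 2 * ∑ c, φ c := by
  rw [← Finset.sum_fiberwise (s := Finset.univ) (g := fun p => Quotient.mk h.orbitSetoid p),
    Finset.mul_sum]
  refine Finset.sum_congr rfl fun c _ => ?_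
  induction c using Quotient.inductionOn with | _ p
  rw [Finset.sum_congr rfl (g := fun _ => φ (Quotient.mk _ p)) fun q hq => by
    rw [(Finset.mem_filter.1 hq).2]]
  have : (Finset.univ.filter fun q => Quotient.mk h.orbitSetoid q = Quotient.mk _ p) = {p, τ p} := by
    ext q
    simp only [Finset.mem_filter_univ, Finset.mem_insert, Finset.mem_singleton]
    exact eq_comm.trans Quotient.eq
  rw [this, Finset.sum_pair (hτ p).symm, two_mul]

/-- Zero-sum arrays may be chosen constant on the orbits of an involution. -/
theorem Function.Involutive.exists_isZeroSumArray {P : Type*} [Fintype P] {τ : P → P}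
    (h : Function.Involutive τ) (hτ : ∀ p, τ p ≠ p) (hP : 2 < Fintype.card P)
    (α : Type*) [Fintype α] [Nontrivial α] :
    ∃ ψ : α → P → ℤ, IsZeroSumArray ψ ∧ ∀ i p, ψ i (τ p) = ψ i p := by
  classical
  -- Orbits have two elements and `P` has more than two, so there are at least two columns to fill.
  have : Nontrivial (Quotient h.orbitSetoid) := by
    have p : P := (Fintype.card_pos_iff.1 (by omega)).some
    obtain ⟨q, hq⟩ : ∃ q, q ∉ ({p, τ p} : Finset P) := by
      by_contra! hc
      have := (Finset.card_le_card (fun q _ => hc q : Finset.univ ⊆ _)).trans Finset.card_le_two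
      rw [Finset.card_univ] at this
      omega
    refine ⟨⟨Quotient.mk _ p, Quotient.mk _ q, fun hpq => hq ?_⟩⟩
    simpa using show q = p ∨ q = τ p from Quotient.exact hpq
  obtain ⟨ψ, hψ⟩ := _root_.exists_isZeroSumArray α (Quotient h.orbitSetoid)
  refine ⟨fun i p => ψ i (Quotient.mk _ p), ⟨fun i p => hψ.bound _ _, fun i => ?_,
    fun p => hψ.sum_col _⟩, fun i p => ?_⟩
  · rw [h.sum_orbit hτ (ψ i), hψ.sum_row, mul_zero]
  · exact congrArg (ψ i) (Quotient.sound (Or.inr (h p).symm : p = τ p ∨ p = τ (τ p)))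

/-! ### Weighted one-factorizations by doubling -/

/-- A one-factorization of the complete graph on `Y` with factors indexed by `X`, together with
edge weights `±1`, `±2` that sum to zero along every factor and around every vertex. The edge of
the factor `x` at the vertex `y` leads to `σ x y` and has weight `w x y`. -/
structure IsZeroSumFactorization {X Y : Type*} [Fintype X] [Fintype Y] (σ : X → Y → Y)
    (w : X → Y → ℤ) : Prop where
  involutive : ∀ x, Function.Involutive (σ x)
  ne : ∀ x y, σ x y ≠ y
  injective : ∀ y, Function.Injective fun x => σ x y
  array : IsZeroSumArray w
  weight : ∀ x y, w x (σ x y) = w x y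

theorem IsZeroSumFactorization.comp_equiv {X X' Y : Type*} [Fintype X] [Fintype X'] [Fintype Y]
    {σ : X → Y → Y} {w : X → Y → ℤ} (h : IsZeroSumFactorization σ w) (e : X' ≃ X) :
    IsZeroSumFactorization (fun x => σ (e x)) fun x => w (e x) :=
  ⟨fun _ => h.involutive _, fun _ => h.ne _, fun y => (h.injective y).comp e.injective,
    h.array.comp_equiv e (Equiv.refl _), fun _ => h.weight _⟩

/-- Doubling a one-factorization. -/
theorem exists_isZeroSumFactorization_double {Z P : Type*} [Fintype Z] [Fintype P] [Nonempty Z]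
    (τ : Z → P → P) (h : ∀ z, Function.Involutive (τ z)) (hne : ∀ z p, τ z p ≠ p)
    (hinj : ∀ p, Function.Injective fun z => τ z p) (hP : 2 < Fintype.card P) :
    ∃ (σ : Option (Z × Bool) → Bool × P → Bool × P) (w : Option (Z × Bool) → Bool × P → ℤ),
      IsZeroSumFactorization σ w := by
  classical
  choose φ hφ hφτ using fun z => (h z).exists_isZeroSumArray (hne z) hP Bool
  let z₀ : Z := Classical.arbitrary Z
  obtain ⟨ψ, hψ, hψτ⟩ := (h z₀).exists_isZeroSumArray (hne z₀) hP (Option Bool)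
  -- Each `z ≠ z₀` gives two factors, which cancel at every vertex by a two-row array. The leftover
  -- factor `none`, joining the two copies of each point, shares a three-row array with the two
  -- factors of `z₀`.
  let w : Option (Z × Bool) → P → ℤ := fun x => x.elim (ψ none) fun x =>
    if x.1 = z₀ then ψ (some x.2) else φ x.1 x.2
  refine ⟨fun x y => x.elim (!y.1, y.2) fun x => (y.1 ^^ x.2, τ x.1 y.2), fun x y => w x y.2,
    ?_, ?_, ?_, ⟨?_, ?_, ?_⟩, ?_⟩
  · rintro (_ | ⟨z, ε⟩) ⟨i, p⟩
    · simp
    · simp [h z p]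
  · rintro (_ | ⟨z, ε⟩) ⟨i, p⟩ <;> simp [hne]
  · rintro ⟨i, p⟩ (_ | ⟨z, ε⟩) (_ | ⟨z', ε'⟩) hx
    · rfl
    · simp [(hne _ _).symm] at hx
    · simp [hne] at hx
    · simp only [Option.elim_some, Prod.mk.injEq, Bool.xor_right_inj] at hx
      simp [hx.1, hinj p hx.2]
  · rintro (_ | ⟨z, ε⟩) ⟨i, p⟩
    · exact hψ.bound _ _
    · by_cases hz : z = z₀
      · simpa [w, hz] using hψ.bound _ _
      · simpa [w, hz] using (hφ z).bound _ _
  · intro x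
    have hx : ∑ p, w x p = 0 := by
      rcases x with _ | ⟨z, ε⟩
      · exact hψ.sum_row _
      · by_cases hz : z = z₀
        · simpa [w, hz] using hψ.sum_row _
        · simpa [w, hz] using (hφ z).sum_row _
    simp [Fintype.sum_prod_type, hx]
  · rintro ⟨i, p⟩
    rw [Fintype.sum_option, Fintype.sum_prod_type, Finset.sum_eq_single z₀ _ (by simp)]
    · simpa [w, Fintype.sum_option] using hψ.sum_col p
    · intro z _ hz
      simpa [w, hz] using (hφ z).sum_col p
  · rintro (_ | ⟨z, ε⟩) ⟨i, p⟩
    · rfl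
    · by_cases hz : z = z₀
      · simp [w, hz, hψτ]
      · simp [w, hz, hφτ]

/-! ### The round-robin factorization -/

theorem ZMod.two_mul_injective (h : ℕ) : Function.Injective fun z : ZMod (2 * h + 1) => 2 * z := by
  intro z z' hz
  have h0 : (2 * h + 1 : ZMod (2 * h + 1)) = 0 := by exact_mod_cast ZMod.natCast_self (2 * h + 1)
  have hz : 2 * z = 2 * z' := hz
  -- `h + 1` is the inverse of `2`.
  linear_combination (h + 1 : ZMod (2 * h + 1)) * hz - (z - z') * h0

/-- The standard one-factorization of the complete graph on `ℤ/(2h+1) ∪ {∞}`. -/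
def roundRobin (h : ℕ) (z : ZMod (2 * h + 1)) :
    Option (ZMod (2 * h + 1)) → Option (ZMod (2 * h + 1))
  | none => some z
  | some a => if a = z then none else some (2 * z - a)

theorem roundRobin_involutive (h : ℕ) (z : ZMod (2 * h + 1)) :
    Function.Involutive (roundRobin h z) := by
  rintro (_ | a)
  · simp [roundRobin]
  · by_cases ha : a = z
    · simp [roundRobin, ha]
    · have : 2 * z - a ≠ z := fun h' => ha (by linear_combination -h')
      simp [roundRobin, ha, this]

theorem roundRobin_ne (h : ℕ) (z : ZMod (2 * h + 1)) (p) : roundRobin h z p ≠ p := by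
  rcases p with _ | a
  · simp [roundRobin]
  · by_cases ha : a = z
    · simp [roundRobin, ha]
    · have : 2 * z - a ≠ a := fun h' => ha (ZMod.two_mul_injective h (by
        show 2 * a = 2 * z
        linear_combination -h'))
      simp [roundRobin, ha, this]

theorem roundRobin_injective (h : ℕ) (p) : Function.Injective fun z => roundRobin h z p := by
  rcases p with _ | a
  · exact fun z z' hz => Option.some_injective _ hz
  · intro z z' hz
    by_cases ha : a = z <;> by_cases ha' : a = z'
    · exact ha.symm.trans ha'
    · simp [roundRobin, ha, ha ▸ ha'] at hz
    · simp [roundRobin, ha', ha' ▸ ha] at hz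
    · simp only [roundRobin, ha, ha', if_false, Option.some.injEq] at hz
      exact ZMod.two_mul_injective h (sub_left_injective hz)

/-! ### The bicyclic factorization -/

/-- Start from `-1` or `-2 + 1`, according to parity, and add pairs `1, -1`. Applied to the orbits
`{a, -a}`, the total `-1` counts twice and cancels a weight `2` at `0`. -/
theorem exists_weight_sum_eq_neg_one (β : Type*) [Fintype β] [Nonempty β] :
    ∃ φ : β → ℤ, (∀ b, 1 ≤ |φ b| ∧ |φ b| ≤ 2) ∧ ∑ b, φ b = -1 := by
  have key : ∀ b : ℕ, ∃ φ : Fin (b + 1) → ℤ, (∀ i, 1 ≤ |φ i| ∧ |φ i| ≤ 2) ∧ ∑ i, φ i = -1 := by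
    intro b
    induction b using Nat.twoStepInduction with
    | zero => exact ⟨![-1], by decide, by decide⟩
    | one => exact ⟨![-2, 1], by decide, by decide⟩
    | more b ih _ =>
      obtain ⟨φ, hφ, hs⟩ := ih
      refine ⟨Fin.cons 1 (Fin.cons (-1) φ), ?_, by simp [Fin.sum_univ_succ (n := b + 2), Fin.sum_univ_succ (n := b + 1), hs]⟩
      refine Fin.cases (by simp) (Fin.cases (by simp) fun i => ?_)
      simpa using hφ i
  obtain ⟨b, hb⟩ := Nat.exists_eq_add_one.2 (Fintype.card_pos (α := β))
  obtain ⟨φ, hφ, hs⟩ := key b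
  exact ⟨fun i => φ (Fintype.equivFinOfCardEq hb i), fun i => hφ _,
    ((Fintype.equivFinOfCardEq hb).sum_comp φ).trans hs⟩

-- Evenness makes `u (a - z)` invariant under the reflection `a ↦ 2 * z - a`, hence well defined on
-- edges.
open Classical in
theorem exists_even_weight (h : ℕ) (hh : 0 < h) :
    ∃ u : ZMod (2 * h + 1) → ℤ, (∀ a, 1 ≤ |u a| ∧ |u a| ≤ 2) ∧ (∀ a, u (-a) = u a) ∧
      ∑ a, u a = 0 := by
  let P := {a : ZMod (2 * h + 1) // a ≠ 0}
  let τ : P → P := fun a => ⟨-a.1, neg_ne_zero.2 a.2⟩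
  have hτ : Function.Involutive τ := fun a => Subtype.ext (neg_neg a.1)
  have hne : ∀ p, τ p ≠ p := fun p hp => p.2 (ZMod.two_mul_injective h (by
    have : -p.1 = p.1 := congrArg Subtype.val hp
    show 2 * p.1 = 2 * 0
    linear_combination -this))
  have : Fact (1 < 2 * h + 1) := ⟨by omega⟩
  have : Nonempty (Quotient hτ.orbitSetoid) := ⟨Quotient.mk _ ⟨1, one_ne_zero⟩⟩
  obtain ⟨φ, hφ, hs⟩ := exists_weight_sum_eq_neg_one (Quotient hτ.orbitSetoid)
  refine ⟨fun a => if ha : a = 0 then 2 else φ (Quotient.mk _ ⟨a, ha⟩), fun a => ?_, fun a => ?_, ?_⟩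
  · by_cases ha : a = 0
    · simp [ha]
    · simpa [ha] using hφ _
  · by_cases ha : a = 0
    · simp [ha]
    · simp only [neg_eq_zero, ha, dif_neg, not_false_eq_true]
      exact congrArg φ (Quotient.sound (Or.inr (Subtype.ext (neg_neg a).symm)))
  · have hP := hτ.sum_orbit hne φ
    rw [hs] at hP
    rw [← Finset.add_sum_erase _ _ (Finset.mem_univ 0),
      Finset.sum_subtype (p := fun a => a ≠ 0) (Finset.univ.erase 0) (by simp),
      Finset.sum_congr rfl fun (a : P) _ => dif_neg a.2, hP]
    norm_num

/-- The difference `2j + 1` or `2j + 2` in `ℤ/(2h+1)`. -/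
def pairedDifference (h : ℕ) (x : Fin h × Bool) : ZMod (2 * h + 1) :=
  ((2 * x.1 + 1 + x.2.toNat : ℕ) : ZMod (2 * h + 1))

theorem pairedDifference_val (h : ℕ) (x : Fin h × Bool) :
    (pairedDifference h x).val = 2 * x.1 + 1 + x.2.toNat := by
  refine ZMod.val_cast_of_lt ?_
  have := x.1.2
  have := x.2.toNat_le
  omega

theorem pairedDifference_ne_zero (h : ℕ) (x : Fin h × Bool) : pairedDifference h x ≠ 0 := by
  intro hx
  have := pairedDifference_val h x
  rw [hx, ZMod.val_zero] at this
  omega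

theorem pairedDifference_injective (h : ℕ) : Function.Injective (pairedDifference h) := by
  rintro ⟨j, ε⟩ ⟨j', ε'⟩ hx
  have := congrArg ZMod.val hx
  simp only [pairedDifference_val] at this
  have hj : j = j' ∧ ε = ε' := by
    cases ε <;> cases ε' <;> simp at this ⊢ <;> omega
  simp [hj]

/-- The standard one-factorization of the complete graph on two copies of `ℤ/(2h+1)`. -/
def bicyclic (h : ℕ) : ZMod (2 * h + 1) ⊕ Fin h × Bool →
    Bool × ZMod (2 * h + 1) → Bool × ZMod (2 * h + 1)
  | .inl z, (i, a) => if a = z then (!i, a) else (i, 2 * z - a)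
  | .inr x, (false, a) => (true, a + pairedDifference h x)
  | .inr x, (true, a) => (false, a - pairedDifference h x)

theorem bicyclic_involutive (h : ℕ) (x) : Function.Involutive (bicyclic h x) := by
  rcases x with z | x
  · rintro ⟨i, a⟩
    by_cases ha : a = z
    · simp [bicyclic, ha]
    · have : 2 * z - a ≠ z := fun h' => ha (by linear_combination -h')
      simp [bicyclic, ha, this]
  · rintro ⟨_ | _, a⟩ <;> simp [bicyclic]

theorem bicyclic_ne (h : ℕ) (x y) : bicyclic h x y ≠ y := by
  rcases x with z | x
  · rcases y with ⟨i, a⟩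
    by_cases ha : a = z
    · simp [bicyclic, ha]
    · have : 2 * z - a ≠ a := fun h' => ha (ZMod.two_mul_injective h (by
        show 2 * a = 2 * z
        linear_combination -h'))
      simp [bicyclic, ha, this]
  · rcases y with ⟨_ | _, a⟩ <;> simp [bicyclic]

theorem bicyclic_injective (h : ℕ) (y) : Function.Injective fun x => bicyclic h x y := by
  have mixed : ∀ z x, bicyclic h (.inl z) y ≠ bicyclic h (.inr x) y := by
    intro z x
    obtain ⟨i, a⟩ := y
    have hx := pairedDifference_ne_zero h x
    by_cases ha : a = z <;> cases i <;> simp [bicyclic, ha, hx, eq_comm (a := z)]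
  rintro (z | x) (z' | x') hx
  · obtain ⟨i, a⟩ := y
    by_cases ha : a = z <;> by_cases ha' : a = z'
    · simp [← ha, ← ha']
    · simp [bicyclic, ha, ha ▸ ha'] at hx
    · simp [bicyclic, ha', ha' ▸ ha] at hx
    · simp only [bicyclic, ha, ha', if_false, Prod.mk.injEq, true_and] at hx
      exact congrArg _ (ZMod.two_mul_injective h (sub_left_injective hx))
  · exact (mixed _ _ hx).elim
  · exact (mixed _ _ hx.symm).elim
  · obtain ⟨_ | _, a⟩ := y
    · simp only [bicyclic, Prod.mk.injEq, add_right_inj, true_and] at hx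
      rw [pairedDifference_injective h hx]
    · simp only [bicyclic, Prod.mk.injEq, sub_right_inj, true_and] at hx
      rw [pairedDifference_injective h hx]

/-- Weights on `bicyclic`: an even function `u` of the difference within each copy, and the rows of
`ψ` with alternating signs between the copies. -/
def bicyclicWeight (h : ℕ) (u : ZMod (2 * h + 1) → ℤ) (ψ : Fin h → ZMod (2 * h + 1) → ℤ) :
    ZMod (2 * h + 1) ⊕ Fin h × Bool → Bool × ZMod (2 * h + 1) → ℤ
  | .inl z, (_, a) => u (a - z)
  | .inr (j, false), (false, a) => ψ j (a + pairedDifference h (j, false))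
  | .inr (j, true), (false, a) => -ψ j (a + pairedDifference h (j, false))
  | .inr (j, false), (true, a) => ψ j a
  | .inr (j, true), (true, a) => -ψ j (a - 1)

/-- The factors `j, false` and `j, true` have opposite weights at each vertex of the copy `false`.
In the copy `true` the second is shifted by `1`, the gap between the two differences, so
cancellation there comes from the column sums of `ψ`; this array needs two rows, hence `2 ≤ h`. -/
theorem exists_isZeroSumFactorization_bicyclic (h : ℕ) (hh : 2 ≤ h) :
    ∃ w, IsZeroSumFactorization (bicyclic h) w := by
  have : Nontrivial (Fin h) := Fin.nontrivial_iff_two_le.2 hh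
  have : Fact (1 < 2 * h + 1) := ⟨by omega⟩
  obtain ⟨u, hu, hneg, hsum⟩ := exists_even_weight h (by omega)
  obtain ⟨ψ, hψ⟩ := exists_isZeroSumArray (Fin h) (ZMod (2 * h + 1))
  have hshift (j c) : ∑ a, ψ j (a + c) = 0 :=
    (Equiv.sum_comp (Equiv.addRight c) (ψ j)).trans (hψ.sum_row j)
  have hshift' (j c) : ∑ a, ψ j (a - c) = 0 :=
    (Equiv.sum_comp (Equiv.subRight c) (ψ j)).trans (hψ.sum_row j)
  have husub (z) : ∑ a, u (a - z) = 0 := ((Equiv.subRight z).sum_comp u).trans hsum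
  have husub' (a) : ∑ z, u (a - z) = 0 := ((Equiv.subLeft a).sum_comp u).trans hsum
  refine ⟨bicyclicWeight h u ψ, bicyclic_involutive h, bicyclic_ne h, bicyclic_injective h,
    ⟨?_, ?_, ?_⟩, ?_⟩
  · rintro (z | ⟨j, _ | _⟩) ⟨_ | _, a⟩ <;> simp only [bicyclicWeight, abs_neg] <;>
      first | exact hu _ | exact hψ.bound _ _
  · rintro (z | ⟨j, _ | _⟩) <;>
      simp [Fintype.sum_prod_type, bicyclicWeight, hshift, hshift', husub, hψ.sum_row]
  · rintro ⟨_ | _, a⟩ <;>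
      simp [Fintype.sum_prod_type, bicyclicWeight, husub', Finset.sum_add_distrib, hψ.sum_col]
  · rintro (z | ⟨j, ε⟩) ⟨i, a⟩
    · by_cases ha : a = z
      · simp [bicyclic, bicyclicWeight, ha]
      · simp only [bicyclic, ha, if_false, bicyclicWeight]
        rw [← hneg]
        congr 1
        ring
    · have hd : pairedDifference h (j, true) = pairedDifference h (j, false) + 1 := by
        simp [pairedDifference]
      cases ε <;> cases i <;> simp [bicyclic, bicyclicWeight, hd]
      · congr 1; ring
      · congr 1; ring

theorem exists_isZeroSumFactorization {X : Type*} [Fintype X] (hodd : Odd (Fintype.card X))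
    (hX : 7 ≤ Fintype.card X) :
    ∃ (Y : Type) (_ : Fintype Y) (σ : X → Y → Y) (w : X → Y → ℤ),
      Fintype.card Y = Fintype.card X + 1 ∧ IsZeroSumFactorization σ w := by
  obtain ⟨r, hr⟩ := hodd
  obtain ⟨s, rfl | rfl⟩ := Nat.even_or_odd' r
  · obtain ⟨w, h⟩ := exists_isZeroSumFactorization_bicyclic s (by omega)
    refine ⟨_, inferInstance, _, _, ?_, h.comp_equiv (Fintype.equivOfCardEq ?_)⟩
    · simp [ZMod.card]; omega
    · simp [ZMod.card]; omega
  · obtain ⟨σ, w, h⟩ := exists_isZeroSumFactorization_double (roundRobin s)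
      (roundRobin_involutive s) (roundRobin_ne s) (roundRobin_injective s)
      (by simp [ZMod.card]; omega)
    refine ⟨_, inferInstance, _, _, ?_, h.comp_equiv (Fintype.equivOfCardEq ?_)⟩
    · simp [ZMod.card]; omega
    · simp [ZMod.card]; omega

/-! ### The extended triple system and its flow -/

namespace SteinerTripleSystem

open Classical in
/-- The block joining the point `x` to the edge of the factor `x` at the vertex `y`. -/
noncomputable def joinBlock {X Y : Type*} (σ : X → Y → Y) (x : X) (y : Y) : Finset (X ⊕ Y) :=
  {.inl x, .inr y, .inr (σ x y)}

section joinBlock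

variable {X Y : Type*} {σ : X → Y → Y}

@[simp]
theorem inl_mem_joinBlock {x x' : X} {y : Y} : Sum.inl x' ∈ joinBlock σ x y ↔ x' = x := by
  simp [joinBlock]

@[simp]
theorem inr_mem_joinBlock {x : X} {y y' : Y} :
    Sum.inr y' ∈ joinBlock σ x y ↔ y' = y ∨ y' = σ x y := by
  simp [joinBlock]

theorem joinBlock_eq_iff (hσ : ∀ x, Function.Involutive (σ x)) {x x' : X} {y y' : Y} :
    joinBlock σ x' y' = joinBlock σ x y ↔ x' = x ∧ (y' = y ∨ y' = σ x y) := by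
  constructor
  · intro h
    have hx : Sum.inl x' ∈ joinBlock σ x y := h ▸ inl_mem_joinBlock.2 rfl
    have hy : Sum.inr y' ∈ joinBlock σ x y := h ▸ inr_mem_joinBlock.2 (Or.inl rfl)
    exact ⟨inl_mem_joinBlock.1 hx, inr_mem_joinBlock.1 hy⟩
  · rintro ⟨rfl, rfl | rfl⟩
    · rfl
    · ext (z | z)
      · simp
      · simp [hσ x' y, or_comm]

end joinBlock

variable {n : ℕ} {X : Type u} {Y : Type v} [Fintype X] (S : SteinerTripleSystem n X)
  {σ : X → Y → Y} {w : X → Y → ℤ}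

/-- The weights of the blocks of the extension. -/
noncomputable def extensionWeight (σ : X → Y → Y) (w : X → Y → ℤ)
    (f : {B : Finset X // B ∈ S.blocks} → ℤ) : Finset (X ⊕ Y) → ℤ :=
  -- The default `0` is never taken on a block of the extension.
  Function.extend (fun A : {B : Finset X // B ∈ S.blocks} => A.1.map Function.Embedding.inl) f
    (Function.extend (fun p : X × Y => joinBlock σ p.1 p.2) (fun p => w p.1 p.2) 0)

theorem extensionWeight_map (f : {B : Finset X // B ∈ S.blocks} → ℤ)
    (A : {B : Finset X // B ∈ S.blocks}) :
    S.extensionWeight σ w f (A.1.map Function.Embedding.inl) = f A :=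
  Function.Injective.extend_apply
    (fun _ _ h => Subtype.ext (Finset.map_injective Function.Embedding.inl h)) _ _ _

variable [Fintype Y]

open Classical in
/-- The blocks of `S` and the triples formed by a point of `S` and an edge of its factor. -/
noncomputable def extensionBlocks (σ : X → Y → Y) : Finset (Finset (X ⊕ Y)) :=
  S.blocks.map (Finset.mapEmbedding Function.Embedding.inl).toEmbedding ∪
    Finset.univ.image fun p : X × Y => joinBlock σ p.1 p.2

variable {S} in
theorem mem_extensionBlocks {B : Finset (X ⊕ Y)} : B ∈ S.extensionBlocks σ ↔
    (∃ A ∈ S.blocks, A.map Function.Embedding.inl = B) ∨ ∃ x y, joinBlock σ x y = B := by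
  simp [extensionBlocks]

/-- The extension of a Steiner triple system by a one-factorization. -/
noncomputable def extension (hw : IsZeroSumFactorization σ w) (hY : Fintype.card Y = n + 1) :
    SteinerTripleSystem (2 * n + 1) (X ⊕ Y) where
  blocks := S.extensionBlocks σ
  card_points := by rw [Fintype.card_sum, S.card_points, hY]; ring
  card_block B hB := by
    classical
    rcases mem_extensionBlocks.1 hB with ⟨A, hA, rfl⟩ | ⟨x, y, rfl⟩
    · rw [Finset.card_map, S.card_block A hA]
    · rw [joinBlock, Finset.card_eq_three]
      exact ⟨_, _, _, by simp, by simp, by simpa using (hw.ne x y).symm, rfl⟩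
  existsUnique_block := by
    classical
    -- The factors are disjoint at `y`, and there are as many as other vertices, so every edge lies
    -- in one.
    have surj : ∀ y y', y ≠ y' → ∃ x, σ x y = y' := by
      intro y y' hyy'
      have hinj : Function.Injective fun x => (⟨σ x y, hw.ne x y⟩ : {z // z ≠ y}) :=
        fun x x' h => hw.injective y (congrArg Subtype.val h)
      have hcard : Fintype.card X = Fintype.card {z // z ≠ y} := by
        rw [Fintype.card_subtype_compl, Fintype.card_subtype_eq, hY, S.card_points]; rfl
      obtain ⟨x, hx⟩ := ((Fintype.bijective_iff_injective_and_card _).2 ⟨hinj, hcard⟩).2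
        ⟨y', hyy'.symm⟩
      exact ⟨x, congrArg Subtype.val hx⟩
    have mixed : ∀ x y, ∃! B, B ∈ S.extensionBlocks σ ∧ Sum.inl x ∈ B ∧ Sum.inr y ∈ B := by
      refine fun x y => ⟨joinBlock σ x y, ⟨mem_extensionBlocks.2 (Or.inr ⟨x, y, rfl⟩),
        by simp, by simp⟩, ?_⟩
      rintro B ⟨hB, hx, hy⟩
      rcases mem_extensionBlocks.1 hB with ⟨A, hA, rfl⟩ | ⟨x', y', rfl⟩
      · simp at hy
      · rw [inl_mem_joinBlock] at hx
        subst hx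
        exact ((joinBlock_eq_iff hw.involutive).2 ⟨rfl, inr_mem_joinBlock.1 hy⟩).symm
    rintro (x | y) (x' | y') h
    · obtain ⟨A, ⟨hA, hx, hx'⟩, huniq⟩ := S.existsUnique_block x x' (fun e => h (congrArg _ e))
      refine ⟨A.map Function.Embedding.inl,
        ⟨mem_extensionBlocks.2 (Or.inl ⟨A, hA, rfl⟩), by simpa, by simpa⟩, ?_⟩
      rintro B ⟨hB, hxB, hxB'⟩
      rcases mem_extensionBlocks.1 hB with ⟨A', hA', rfl⟩ | ⟨z, y', rfl⟩
      · rw [huniq A' ⟨hA', by simpa using hxB, by simpa using hxB'⟩]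
      · rw [inl_mem_joinBlock] at hxB hxB'
        exact (h (by rw [hxB, hxB'])).elim
    · exact mixed x y'
    · simpa only [and_comm (a := Sum.inr y ∈ _)] using mixed x' y
    · obtain ⟨x, rfl⟩ := surj y y' (fun e => h (congrArg _ e))
      refine ⟨joinBlock σ x y, ⟨mem_extensionBlocks.2 (Or.inr ⟨x, y, rfl⟩), by simp, by simp⟩, ?_⟩
      rintro B ⟨hB, hyB, hyB'⟩
      rcases mem_extensionBlocks.1 hB with ⟨A, hA, rfl⟩ | ⟨x', z, rfl⟩
      · simp at hyB
      · rw [inr_mem_joinBlock] at hyB hyB'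
        have hx : σ x y = σ x' y := by
          rcases hyB with rfl | rfl <;> rcases hyB' with h' | h'
          · exact (hw.ne _ _ h').elim
          · exact h'
          · rw [h', hw.involutive]
          · exact (hw.ne _ _ h').elim
        cases hw.injective y hx
        exact ((joinBlock_eq_iff hw.involutive).2 ⟨rfl, hyB⟩).symm

theorem extensionWeight_joinBlock (hw : IsZeroSumFactorization σ w)
    (f : {B : Finset X // B ∈ S.blocks} → ℤ) (x : X) (y : Y) :
    S.extensionWeight σ w f (joinBlock σ x y) = w x y := by
  rw [extensionWeight, Function.extend_apply']
  · refine Function.FactorsThrough.extend_apply (f := fun p : X × Y => joinBlock σ p.1 p.2)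
      (g := fun p => w p.1 p.2) ?_ 0 (x, y)
    rintro ⟨x, y⟩ ⟨x', y'⟩ h
    obtain ⟨hx, hy⟩ := (joinBlock_eq_iff hw.involutive).1 h
    dsimp only at hx hy ⊢
    obtain ⟨rfl, rfl | rfl⟩ := And.intro hx hy
    · rfl
    · exact hw.weight _ _
  · rintro ⟨A, hA⟩
    have : Sum.inr y ∈ A.1.map Function.Embedding.inl := hA ▸ inr_mem_joinBlock.2 (Or.inl rfl)
    simp at this

open Classical in
theorem sum_extensionBlocks (G : Finset (X ⊕ Y) → ℤ) :
    ∑ B ∈ S.extensionBlocks σ, G B = ∑ A : {B : Finset X // B ∈ S.blocks},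
      G (A.1.map Function.Embedding.inl) +
        ∑ B ∈ Finset.univ.image fun p : X × Y => joinBlock σ p.1 p.2, G B := by
  rw [extensionBlocks, Finset.sum_union, Finset.sum_map, ← Finset.sum_coe_sort S.blocks]
  · rfl
  · rw [Finset.disjoint_left]
    intro B hB hB'
    obtain ⟨A, -, rfl⟩ := Finset.mem_map.1 hB
    obtain ⟨⟨x, y⟩, -, h⟩ := Finset.mem_image.1 hB'
    have : Sum.inr y ∈ A.map Function.Embedding.inl :=
      (show joinBlock σ x y = A.map _ from h) ▸ inr_mem_joinBlock.2 (Or.inl rfl)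
    simp at this

theorem extension_isZeroSumFlow (hw : IsZeroSumFactorization σ w)
    (hY : Fintype.card Y = n + 1) {k : ℕ} (hk : 3 ≤ k) {f : {B : Finset X // B ∈ S.blocks} → ℤ}
    (hf : S.IsZeroSumFlow k f) :
    (S.extension hw hY).IsZeroSumFlow k fun B => S.extensionWeight σ w f B.1 := by
  classical
  refine ⟨?_, fun p => ?_⟩
  · rintro ⟨B, hB⟩
    rcases mem_extensionBlocks.1 hB with ⟨A, hA, rfl⟩ | ⟨x, y, rfl⟩
    · dsimp only
      rw [S.extensionWeight_map f ⟨A, hA⟩]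
      exact hf.1 _
    · dsimp only
      rw [S.extensionWeight_joinBlock hw]
      have := hw.array.bound x y
      omega
  · rw [Finset.sum_filter]
    refine (Finset.sum_congr rfl fun B _ => ?_).trans ((Finset.sum_coe_sort (S.extensionBlocks σ)
      fun B => if p ∈ B then S.extensionWeight σ w f B else 0).trans ?_)
    · congr
    rw [sum_extensionBlocks]
    rcases p with x | y
    · have h1 := hf.2 x
      rw [Finset.sum_filter] at h1
      -- Summing over vertices counts each edge of the factor `x`, hence each new block through `x`,
      -- twice.
      have h2 : ∑ y, w x y = 2 * ∑ B ∈ Finset.univ.image (fun y => joinBlock σ x y),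
          S.extensionWeight σ w f B := by
        rw [← Finset.sum_congr rfl fun y _ => S.extensionWeight_joinBlock hw f x y,
          Finset.sum_comp (S.extensionWeight σ w f) (fun y => joinBlock σ x y), Finset.mul_sum]
        refine Finset.sum_congr rfl fun B hB => ?_
        obtain ⟨y, -, rfl⟩ := Finset.mem_image.1 hB
        have : (Finset.univ.filter fun y' => joinBlock σ x y' = joinBlock σ x y) = {y, σ x y} := by
          ext y'
          simp [joinBlock_eq_iff hw.involutive]
        rw [this, Finset.card_pair (hw.ne x y).symm, two_nsmul, two_mul]
      rw [hw.array.sum_row] at h2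
      have h3 : ((Finset.univ.image fun p : X × Y => joinBlock σ p.1 p.2).filter
          fun B => Sum.inl x ∈ B) = Finset.univ.image fun y => joinBlock σ x y := by
        ext B
        simp only [Finset.mem_filter, Finset.mem_image, Finset.mem_univ, true_and, Prod.exists]
        constructor
        · rintro ⟨⟨x', y, rfl⟩, h⟩
          exact ⟨y, by rw [inl_mem_joinBlock.1 h]⟩
        · rintro ⟨y, rfl⟩
          exact ⟨⟨x, y, rfl⟩, inl_mem_joinBlock.2 rfl⟩
      rw [← Finset.sum_filter (s := Finset.image _ _), h3, (mul_eq_zero.1 h2.symm).resolve_left two_ne_zero,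
        add_zero]
      refine (Finset.sum_congr rfl fun A _ => ?_).trans h1
      simp [extensionWeight_map]
    · have h3 : ((Finset.univ.image fun p : X × Y => joinBlock σ p.1 p.2).filter
          fun B => Sum.inr y ∈ B) = Finset.univ.image fun x => joinBlock σ x y := by
        ext B
        simp only [Finset.mem_filter, Finset.mem_image, Finset.mem_univ, true_and, Prod.exists]
        constructor
        · rintro ⟨⟨x, y', rfl⟩, h⟩
          exact ⟨x, (joinBlock_eq_iff hw.involutive).2 ⟨rfl, inr_mem_joinBlock.1 h⟩⟩
        · rintro ⟨x, rfl⟩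
          exact ⟨⟨x, y, rfl⟩, inr_mem_joinBlock.2 (Or.inl rfl)⟩
      rw [← Finset.sum_filter (s := Finset.image _ _), h3, Finset.sum_image
        fun x _ x' _ h => ((joinBlock_eq_iff hw.involutive).1 h).1,
        Finset.sum_congr rfl fun x _ => S.extensionWeight_joinBlock hw f x y, hw.array.sum_col]
      simp

end SteinerTripleSystem

theorem mainTheorem3 {n k : ℕ}
    (hnk : (3 ≤ k ∧ (n ≡ 3 [MOD 12] ∨ n ≡ 7 [MOD 12]) ∧ 7 < n) ∨
      (4 ≤ k ∧ n ≡ 9 [MOD 12] ∧ 9 < n) ∨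
      (5 ≤ k ∧ ((n ≡ 1 [MOD 12] ∧ 1 < n) ∨ n = 9)))
    {X : Type u} [Fintype X] (S : SteinerTripleSystem n X)
    (f : {B : Finset X // B ∈ S.blocks} → ℤ) (hf : S.IsZeroSumFlow k f) :
    ∃ (Y : Type u) (_ : Fintype Y) (T : SteinerTripleSystem (2 * n + 1) Y) (e : S.Embedding T)
      (g : {B : Finset Y // B ∈ T.blocks} → ℤ),
      T.IsZeroSumFlow k g ∧ ∀ B, g (e.mapBlock B) = f B := by
  have h : 3 ≤ k ∧ n % 2 = 1 ∧ 7 ≤ n := by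
    unfold Nat.ModEq at hnk
    omega
  obtain ⟨hk, hodd, hn⟩ := h
  obtain ⟨Y, _, σ, w, hY, hw⟩ := exists_isZeroSumFactorization (X := X)
    (by rw [S.card_points]; exact Nat.odd_iff.2 hodd) (by rwa [S.card_points])
  rw [S.card_points] at hY
  exact ⟨X ⊕ Y, inferInstance, S.extension hw hY, ⟨Function.Embedding.inl, fun A hA =>
    SteinerTripleSystem.mem_extensionBlocks.2 (Or.inl ⟨A, hA, rfl⟩)⟩, _,
    S.extension_isZeroSumFlow hw hY hk hf, S.extensionWeight_map f⟩
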